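/- **Definitions.** For a word $w=w_1\dots w_N$ over a finite alphabet $\Sigma$ and $1\le i\le N$ put $\sigma(w,i)=\max(\{0\}\cup\{j\in\mathbb N: j\le i,\ w_{j-1}=w_i\})$ (so $2\le j$ whenever $j$ qualifies), and let $w_0:=\bot$. The *induction-heads (1-hop) task* is to compute $w_{\sigma(w,i)}\in\Sigma\cup\{\bot\}$ for every $i$. An *attention head* consists of functions $Q,K,V:\mathbb R^d\to\mathbb R^m$, applied to each row of $X\in\mathbb R^{N\times d}$, and a matrix $W\in\mathbb R^{m\times d}$. With queries $q_i=Q(X_i)$, keys $k_j=K(X_j)$, values $v_j=V(X_j)$ and weights $w_{i,j}$ determined by the queries and keys, it outputs the matrix with rows $\big(\sum_j w_{i,j}v_j\big)W$. A *layer* is the sum of $H$ heads; a *transformer* with $L$ layers, $H$ heads per layer and embedding dimension $m$ applies $L$ layers in succession and then a function $\psi:\mathbb R^d\to\mathbb R^d$ to each row. It has *$p$-bit precision* if all $Q,K,V,\psi$ depend on their argument only through its coordinatewise rounding to the nearest multiple of $2^{-p}$, clamped to $[-2^p,2^p]$, and all their values and all entries of the matrices $W$ are multiples of $2^{-p}$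 in $[-2^p,2^p]$; otherwise these functions are arbitrary. Let $\mathcal N(q,t)=\{j:\|q-k_j\|\le t\}$ (Euclidean norm). Weights satisfy the *ANNA conditions* with parameters $r,c,\ell$ if $w_{i,j}\ge 0$, $\sum_j w_{i,j}=1$, $w_{i,j}>0\Rightarrow j\in\mathcal N(q_i,cr)$, and $j\in\mathcal N(q_i,r)\Rightarrow w_{i,j}\ge \frac1{(|\mathcal N(q_i,cr)|-1)\ell+1}$, for all $i,j$. An *ANNA mechanism* with parameters $r,c,\ell,\eta$ is a (possibly randomized) rule that turns queries and keys into weights such that, for any fixed queries and keys for which every query has a key within distance $r$, the ANNA conditions fail with probability at most $\eta$. *Exact-match attention* (the case $r=0$) is the rule $w_{i,j}=1/|\{j':k_{j'}=q_i\}|$ if $k_j=q_i$ and $w_{i,j}=0$ otherwise. Letters are represented by the numbers $1,\dots,|\Sigma|$ (under any numbering of $\Sigma$) and $\bot$ by $0$. The input on the word $w$ is the matrix with rows $(w_i,i,0,\dots,0)\in\mathbb R^d$, and a transformer is correct on $w$ if its $i$-th output row is $(w_{\sigma(w,i)},0,\dots,0)$ for every $i\in[N]$. **Theorem.** There is an absolute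 constant $C_0$ such that for all $0<\varepsilon<\varepsilon'<1$ and every $\kappa\in\mathbb N$ there is a constant $C=C(\varepsilon,\varepsilon',\kappa)$ such that for every $N\ge1$ and every finite alphabet $\Sigma$ with $|\Sigma|\le \kappa N$ there is a transformer $T$ as above with $$L\le \frac{C_0}{\varepsilon(\varepsilon'-\varepsilon)^2}\ (=O(1))\ \text{layers},\qquad H\le C N^{(\varepsilon'-\varepsilon)/4}\ \text{heads per layer},\qquad m\le CN^{\varepsilon'},\qquad 2\le d\le CN^{\varepsilon'},$$ and with $p$-bit precision for some $p\le C(1+\log N)$, that solves the induction-heads task as an ANNA-transformer: 1. if every head uses exact-match attention, $T$ is correct on all $w\in\Sigma^N$, i.e. $T(w)_i=w_{\sigma(w,i)}$ for all $i\in[N]$; 2. there is $r_0>0$ such that for all $r\ge0$, $c\ge1$ with $cr\le r_0$, all $1\le\ell\le\kappa N^{\kappa}$ and all $\eta\geq 0$: if the heads are implemented by any ANNA mechanisms with parameters $r,c,\ell,\eta$ (on a common probability space, with any joint law), then for each $w\in\Sigma^N$ the probability that $T$ is not correct on $w$ is at most $LH\eta$. -/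

import Mathlib

open scoped ENNReal

/-! ### The induction-heads task -/

/-- The letter `w_t` in the 1-based numbering `w = w_1 … w_N`; it is `none` (that is, `⊥`) when `t`
is not one of the positions `1, …, N`, in particular when `t = 0`. -/
def letterAt {S : Type*} {N : ℕ} (w : Fin N → S) (t : ℕ) : Option S :=
  if h : 1 ≤ t ∧ t ≤ N then some (w ⟨t - 1, by omega⟩) else none

/-- `σ(w, i) = max ({0} ∪ {j ∈ ℕ : j ≤ i, w_{j-1} = w_i})`, for a 1-based position `i`.
(For `j ≤ 1` the letter `w_{j-1}` is `none`, so such `j` never qualify.) -/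
noncomputable def sigmaIdx {S : Type*} {N : ℕ} (w : Fin N → S) (i : ℕ) : ℕ :=
  sSup ({0} ∪ {j : ℕ | j ≤ i ∧ letterAt w (j - 1) = letterAt w i})

/-- The required output at the position with 0-based index `i`: the letter `w_{σ(w, i)}`, and `none`
(that is, `⊥`) if `σ(w, i) = 0`. -/
noncomputable def inductionHead {S : Type*} {N : ℕ} (w : Fin N → S) (i : Fin N) : Option S :=
  letterAt w (sigmaIdx w (i.val + 1))

/-! ### Attention heads and transformers -/

/-- An attention head: query, key and value embedding functions `ℝ^d → ℝ^m` (they are applied row by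
row) and the `m × d` output matrix. -/
structure AttnHead (d m : ℕ) where
  Q : (Fin d → ℝ) → (Fin m → ℝ)
  K : (Fin d → ℝ) → (Fin m → ℝ)
  V : (Fin d → ℝ) → (Fin m → ℝ)
  W : Matrix (Fin m) (Fin d) ℝ

/-- The architecture of a transformer with `L` layers, `H` heads per layer, row dimension `d` and
embedding dimension `m`: the heads and the row-wise output function. How the heads turn queries and
keys into attention weights is specified separately. -/
structure Transformer (L H d m : ℕ) where
  head : Fin L → Fin H → AttnHead d m
  out : (Fin d → ℝ) → (Fin d → ℝ)

/-- A rule that assigns, to `N` queries and `N` keys in `ℝ^m`, the attention weights `w_{i,j}`. -/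
abbrev WeightRule (N m : ℕ) : Type :=
  (Fin N → Fin m → ℝ) → (Fin N → Fin m → ℝ) → Matrix (Fin N) (Fin N) ℝ

/-- The output of a head on `X`: row `i` is `(∑ j, w_{i,j} v_j) W`. -/
noncomputable def AttnHead.apply {N d m : ℕ} (h : AttnHead d m) (A : WeightRule N m)
    (X : Matrix (Fin N) (Fin d) ℝ) : Matrix (Fin N) (Fin d) ℝ :=
  A (fun i => h.Q (X i)) (fun j => h.K (X j)) * Matrix.of (fun j => h.V (X j)) * h.W

/-- `X^{(t)}` : the rows after the first `t` layers, where a layer sums the outputs of its heads. -/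
noncomputable def Transformer.state {N L H d m : ℕ} (T : Transformer L H d m)
    (A : Fin L → Fin H → WeightRule N m) (X : Matrix (Fin N) (Fin d) ℝ) :
    ℕ → Matrix (Fin N) (Fin d) ℝ
  | 0 => X
  | t + 1 =>
    if ht : t < L then
      ∑ h : Fin H, (T.head ⟨t, ht⟩ h).apply (A ⟨t, ht⟩ h) (T.state A X t)
    else T.state A X t

/-- The output of the transformer: the output function applied to every row of `X^{(L)}`. -/
noncomputable def Transformer.eval {N L H d m : ℕ} (T : Transformer L H d m)
    (A : Fin L → Fin H → WeightRule N m) (X : Matrix (Fin N) (Fin d) ℝ) :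
    Matrix (Fin N) (Fin d) ℝ :=
  Matrix.of fun i => T.out (T.state A X L i)

/-! ### Bit precision -/

/-- Rounding to a signed fixed-point number with `p` fractional and `p` integer bits: the nearest
multiple of `2^{-p}`, clamped to `[-2^p, 2^p]`. -/
noncomputable def roundBits (p : ℕ) (x : ℝ) : ℝ :=
  ((max (-(4 : ℤ) ^ p) (min ((4 : ℤ) ^ p) (round ((2 : ℝ) ^ p * x))) : ℤ) : ℝ) / (2 : ℝ) ^ p

/-- The signed fixed-point numbers with `p` fractional and `p` integer bits. -/
def fixedPoint (p : ℕ) : Set ℝ :=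
  {x | ∃ a : ℤ, |a| ≤ (4 : ℤ) ^ p ∧ x = (a : ℝ) / (2 : ℝ) ^ p}

/-- A function `ℝ^d → ℝ^n` that is arbitrary up to bit precision: it reads its input only after
rounding to `p`-bit fixed-point numbers, and its values are vectors of such numbers. -/
def HasBitPrecision (p : ℕ) {d n : ℕ} (g : (Fin d → ℝ) → (Fin n → ℝ)) : Prop :=
  (∀ x, g x = g (fun t => roundBits p (x t))) ∧ ∀ x s, g x s ∈ fixedPoint p

/-- All element-wise functions and all matrices of the transformer obey `p`-bit precision. -/
def Transformer.HasPrecision {L H d m : ℕ} (T : Transformer L H d m) (p : ℕ) : Prop :=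
  (∀ l h, HasBitPrecision p (T.head l h).Q ∧ HasBitPrecision p (T.head l h).K ∧
    HasBitPrecision p (T.head l h).V ∧ ∀ s t, (T.head l h).W s t ∈ fixedPoint p) ∧
  HasBitPrecision p T.out

/-! ### Approximate nearest neighbor attention -/

/-- Euclidean distance in `ℝ^m`. -/
noncomputable def eucDist {m : ℕ} (x y : Fin m → ℝ) : ℝ :=
  dist (WithLp.toLp 2 x : EuclideanSpace ℝ (Fin m)) (WithLp.toLp 2 y)

/-- The number `|𝒩(q, t)|` of keys (counted with multiplicity) within distance `t` of `q`. -/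
noncomputable def nbrCount {N m : ℕ} (k : Fin N → Fin m → ℝ) (q : Fin m → ℝ) (t : ℝ) : ℕ :=
  Set.ncard {j : Fin N | eucDist q (k j) ≤ t}

/-- The conditions on the attention weights of ANN attention with parameters `r, c, ℓ`. -/
structure IsANNAWeights {N m : ℕ} (r c ℓ : ℝ) (q k : Fin N → Fin m → ℝ)
    (w : Matrix (Fin N) (Fin N) ℝ) : Prop where
  nonneg : ∀ i j, 0 ≤ w i j
  sum_eq_one : ∀ i, ∑ j, w i j = 1
  near_of_pos : ∀ i j, 0 < w i j → eucDist (q i) (k j) ≤ c * r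
  lower_bound : ∀ i j, eucDist (q i) (k j) ≤ r →
    1 / (((nbrCount k (q i) (c * r) : ℝ) - 1) * ℓ + 1) ≤ w i j

/-- A (possibly randomized) weight rule, with random seed `ω` of law `μ`, is an ANNA mechanism with
parameters `r, c, ℓ, η`: on every fixed family of queries and keys satisfying the promise of
approximate nearest neighbor search (each query has a key within distance `r`), its weights satisfy
the ANNA conditions except with probability at most `η`. (Without a key within distance `c r` of a
query the conditions are contradictory, so some promise is needed.) -/
def IsANNAMechanism {Ω : Type*} [MeasurableSpace Ω] (μ : MeasureTheory.Measure Ω) {N m : ℕ}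
    (r c ℓ : ℝ) (η : ℝ≥0∞) (A : Ω → WeightRule N m) : Prop :=
  ∀ q k : Fin N → Fin m → ℝ, (∀ i, ∃ j, eucDist (q i) (k j) ≤ r) →
    μ {ω | ¬ IsANNAWeights r c ℓ q k (A ω q k)} ≤ η

open Classical in
/-- Exact-match attention, the deterministic special case `r = 0`: a query attends uniformly to the
keys equal to it (and the attention output is `0` if there are none). -/
noncomputable def exactMatch (N m : ℕ) : WeightRule N m :=
  fun q k => Matrix.of fun i j =>
    if k j = q i then 1 / (Set.ncard {j' : Fin N | k j' = q i} : ℝ) else 0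

/-! ### Input and output format -/

/-- The number that represents a letter, for a numbering `e` of the alphabet by `0, …, n - 1`:
letters are represented by `1, …, n`, and `⊥` by `0`. -/
def letterCode {S : Type*} {n : ℕ} (e : S ≃ Fin n) : Option S → ℝ
  | none => 0
  | some a => ((e a).val : ℝ) + 1

/-- The input of the transformer on the word `w`: row `i` holds the letter `w_i`, its (1-based)
position `i`, and zeros. -/
def inputRows {S : Type*} {n N : ℕ} (e : S ≃ Fin n) (d : ℕ) (w : Fin N → S) :
    Matrix (Fin N) (Fin d) ℝ :=
  Matrix.of fun i t =>
    if t.val = 0 then letterCode e (some (w i))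
    else if t.val = 1 then (i.val : ℝ) + 1
    else 0

/-- The output rows that solve the induction-heads task on `w`: row `i` holds the letter
`w_{σ(w, i)}` (or `⊥`), and zeros. -/
noncomputable def solutionRows {S : Type*} {n N : ℕ} (e : S ≃ Fin n) (d : ℕ) (w : Fin N → S) :
    Matrix (Fin N) (Fin d) ℝ :=
  Matrix.of fun i t => if t.val = 0 then letterCode e (inductionHead w i) else 0

/-! ### Fixed-point arithmetic -/

/-! The transformer finds the previous occurrence of each letter by descending a `B`-ary trie over
the positions, one level per layer. With `D = B ^ (k - s)`, a row at the start of layer `s` knows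
the last block of length `D` before its own that contains its letter (`predBlock`). For `D = B ^ k ≥
N` there is only one block, so nothing precedes it; for `D = 1` the answer is the predecessor
itself, and one more layer fetches the letter after it.

A descent step (`predBlock_eq_refineBlock`) needs only the digits at which the letter occurs inside
two coarse blocks, the row's own and its predecessor block. Heads 1 and 2 look these up under the
address (letter, block) and average indicator vectors of digits. The exact weights do not matter: a
digit occurs iff its coordinate is still positive after rounding
(`IsExactAverage.roundBits_sum_pos_iff`). Head 0 copies the token, since a layer has no residual
term.

Queries and keys are `p`-bit vectors, so for `c * r < 2^{-p}` the ANNA conditions put weight only on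
exact matches, and `p` is large enough that every match gets weight at least `2^{-p}`
(`IsANNAWeights.isExactAverage`). Every query has a match (`exists_trueKey_eq_trueQuery`), so
exact-match attention is covered too, and failures are controlled by a union bound over all heads.
Three heads, width `3 + 2 * B` with `B ≈ N^{ε'}`, and `⌈1/ε'⌉ + 1` layers suffice. -/

theorem roundBits_mem_fixedPoint (p : ℕ) (x : ℝ) : roundBits p x ∈ fixedPoint p := by
  have h4 : (0 : ℤ) ≤ 4 ^ p := by positivity
  refine ⟨_, ?_, rfl⟩
  rw [abs_le]
  exact ⟨le_max_left _ _, max_le (by linarith) (min_le_left _ _)⟩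

theorem roundBits_of_mem_fixedPoint {p : ℕ} {x : ℝ} (hx : x ∈ fixedPoint p) :
    roundBits p x = x := by
  obtain ⟨a, ha, rfl⟩ := hx
  have h2 : (2 : ℝ) ^ p ≠ 0 := by positivity
  rw [abs_le] at ha
  rw [roundBits, mul_div_cancel₀ _ h2, round_intCast, min_eq_right ha.2, max_eq_right ha.1]

theorem natCast_mem_fixedPoint {p n : ℕ} (h : n ≤ 2 ^ p) : (n : ℝ) ∈ fixedPoint p := by
  refine ⟨n * 2 ^ p, ?_, ?_⟩
  · rw [abs_of_nonneg (by positivity), show (4 : ℤ) = 2 * 2 by norm_num, mul_pow]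
    gcongr
    exact_mod_cast h
  · push_cast
    field_simp

theorem roundBits_natCast {p n : ℕ} (h : n ≤ 2 ^ p) : roundBits p (n : ℝ) = n :=
  roundBits_of_mem_fixedPoint (natCast_mem_fixedPoint h)

theorem roundBits_zero (p : ℕ) : roundBits p 0 = 0 := by
  simpa using roundBits_natCast (p := p) (n := 0) (by positivity)

/-- One unit in the last place survives rounding; this lets an average of indicators be read as a
set. -/
theorem roundBits_pos {p : ℕ} {x : ℝ} (h : 1 / (2 : ℝ) ^ p ≤ x) : 0 < roundBits p x := by
  have h2 : (0 : ℝ) < 2 ^ p := by positivity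
  have h1 : (1 : ℝ) ≤ 2 ^ p * x := by rwa [div_le_iff₀' h2] at h
  have hr : 1 ≤ round ((2 : ℝ) ^ p * x) := by
    rw [round_eq, Int.le_floor]
    push_cast
    linarith
  rw [roundBits]
  refine div_pos ?_ h2
  have : (0 : ℤ) < max (-(4 : ℤ) ^ p) (min ((4 : ℤ) ^ p) (round ((2 : ℝ) ^ p * x))) :=
    lt_max_of_lt_right (lt_min (by positivity) (by omega))
  exact_mod_cast this

theorem eq_of_mem_fixedPoint_of_abs_sub_lt {p : ℕ} {x y : ℝ} (hx : x ∈ fixedPoint p)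
    (hy : y ∈ fixedPoint p) (h : |x - y| < 1 / (2 : ℝ) ^ p) : x = y := by
  obtain ⟨a, -, rfl⟩ := hx
  obtain ⟨b, -, rfl⟩ := hy
  have h2 : (0 : ℝ) < 2 ^ p := by positivity
  rw [← sub_div, abs_div, abs_of_pos h2, div_lt_div_iff_of_pos_right h2] at h
  have h' : |a - b| < 1 := by exact_mod_cast h
  rw [Int.abs_lt_one_iff] at h'
  rw [sub_eq_zero.1 h']

/-- The function `g`, made to read and to write only `p`-bit numbers. -/
noncomputable def quantize (p : ℕ) {d n : ℕ} (g : (Fin d → ℝ) → (Fin n → ℝ)) :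
    (Fin d → ℝ) → (Fin n → ℝ) :=
  fun x s => roundBits p (g (fun t => roundBits p (x t)) s)

theorem hasBitPrecision_quantize (p : ℕ) {d n : ℕ} (g : (Fin d → ℝ) → (Fin n → ℝ)) :
    HasBitPrecision p (quantize p g) := by
  refine ⟨fun x => ?_, fun x s => roundBits_mem_fixedPoint _ _⟩
  funext s
  simp only [quantize, roundBits_of_mem_fixedPoint (roundBits_mem_fixedPoint _ _)]

/-! ### Weights supported on exact matches -/

theorem eucDist_self {m : ℕ} (x : Fin m → ℝ) : eucDist x x = 0 := dist_self _

theorem eq_of_eucDist_le_zero {m : ℕ} {x y : Fin m → ℝ} (h : eucDist x y ≤ 0) : x = y := by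
  have := dist_le_zero.1 h
  exact (WithLp.toLp_injective 2) this

theorem abs_sub_le_eucDist {m : ℕ} (x y : Fin m → ℝ) (t : Fin m) :
    |x t - y t| ≤ eucDist x y := by
  rw [eucDist, EuclideanSpace.dist_eq]
  refine Real.le_sqrt_of_sq_le ?_
  rw [← Real.dist_eq]
  exact Finset.single_le_sum (f := fun t => dist (x t) (y t) ^ 2)
    (fun _ _ => sq_nonneg _) (Finset.mem_univ t)

/-- The weights are averages over the keys that equal the query, each of these having weight at
least `δ`. -/
structure IsExactAverage {N m : ℕ} (δ : ℝ) (q k : Fin N → Fin m → ℝ)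
    (w : Matrix (Fin N) (Fin N) ℝ) : Prop where
  nonneg : ∀ i j, 0 ≤ w i j
  sum_eq_one : ∀ i, ∑ j, w i j = 1
  eq_zero : ∀ i j, k j ≠ q i → w i j = 0
  lower : ∀ i j, k j = q i → δ ≤ w i j

/-- Unequal `p`-bit vectors differ by at least `2^{-p}` in some coordinate, hence lie further apart
than `c * r`. If `M ≤ N` keys are near, a match has weight at least `1 / ((M - 1) * ℓ + 1) ≥ 1 / (N
* ℓ)`, because `1 ≤ ℓ`. -/
theorem IsANNAWeights.isExactAverage {N m p : ℕ} {r c ℓ : ℝ} {q k : Fin N → Fin m → ℝ}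
    {w : Matrix (Fin N) (Fin N) ℝ} (h : IsANNAWeights r c ℓ q k w)
    (hq : ∀ i t, q i t ∈ fixedPoint p) (hk : ∀ j t, k j t ∈ fixedPoint p)
    (hr : 0 ≤ r) (hc : 1 ≤ c) (hcr : c * r < 1 / 2 ^ p) (hl : 1 ≤ ℓ) (hN : N * ℓ ≤ 2 ^ p) :
    IsExactAverage (1 / 2 ^ p) q k w where
  nonneg := h.nonneg
  sum_eq_one := h.sum_eq_one
  eq_zero i j hne := by
    by_contra hw
    have hd := h.near_of_pos i j (lt_of_le_of_ne (h.nonneg i j) (Ne.symm hw))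
    refine hne (funext fun t => (eq_of_mem_fixedPoint_of_abs_sub_lt (hq i t) (hk j t) ?_).symm)
    exact ((abs_sub_le_eucDist _ _ t).trans hd).trans_lt hcr
  lower i j he := by
    refine le_trans ?_ (h.lower_bound i j (by rw [he, eucDist_self]; exact hr))
    have hle : nbrCount k (q i) (c * r) ≤ N := by
      simpa [nbrCount] using Set.ncard_le_card {j : Fin N | eucDist (q i) (k j) ≤ c * r}
    -- The matching key counts itself, which keeps the denominator positive.
    have hpos : 1 ≤ nbrCount k (q i) (c * r) := by
      refine (Set.ncard_pos (Set.toFinite _)).2 ⟨j, ?_⟩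
      simp only [Set.mem_ofPred_eq, he, eucDist_self]
      positivity
    have h1 : (1 : ℝ) ≤ nbrCount k (q i) (c * r) := by exact_mod_cast hpos
    have h2 : (nbrCount k (q i) (c * r) : ℝ) ≤ N := by exact_mod_cast hle
    refine one_div_le_one_div_of_le ?_ ?_
    · nlinarith [mul_nonneg (sub_nonneg.2 h1) (zero_le_one.trans hl)]
    · nlinarith [mul_le_mul_of_nonneg_right h2 (zero_le_one.trans hl)]

/-- Brings exact-match attention under the ANNA analysis. A query without a match would get a zero
row, whose sum is not one. -/
theorem isANNAWeights_exactMatch {N m : ℕ} {q k : Fin N → Fin m → ℝ}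
    (h : ∀ i, ∃ j, k j = q i) : IsANNAWeights 0 1 1 q k (exactMatch N m q k) := by
  have hset : ∀ i, {j : Fin N | eucDist (q i) (k j) ≤ 1 * 0} = {j | k j = q i} := by
    intro i
    ext j
    simp only [mul_zero, Set.mem_ofPred_eq]
    exact ⟨fun hd => (eq_of_eucDist_le_zero hd).symm, fun he => by rw [he, eucDist_self]⟩
  have hpos : ∀ i, (0 : ℝ) < ({j | k j = q i} : Set (Fin N)).ncard := by
    intro i
    exact_mod_cast (Set.ncard_pos (Set.toFinite _)).2 (h i)
  constructor
  · intro i j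
    simp only [exactMatch, Matrix.of_apply]
    split_ifs <;> positivity
  · intro i
    classical
    simp only [exactMatch, Matrix.of_apply]
    rw [← Finset.sum_filter, Finset.sum_const, nsmul_eq_mul,
      Set.ncard_eq_toFinset_card', Set.toFinset_ofPred]
    have := hpos i
    rw [Set.ncard_eq_toFinset_card', Set.toFinset_ofPred] at this
    convert mul_one_div_cancel this.ne'
  · intro i j hw
    simp only [exactMatch, Matrix.of_apply] at hw
    split_ifs at hw with he
    · rw [he, eucDist_self, mul_zero]
    · exact absurd hw (lt_irrefl _)
  · intro i j hd
    have he := (eq_of_eucDist_le_zero hd).symm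
    simp only [exactMatch, Matrix.of_apply, if_pos he, nbrCount, hset]
    simp

theorem IsExactAverage.sum_eq {N m : ℕ} {δ : ℝ} {q k : Fin N → Fin m → ℝ}
    {w : Matrix (Fin N) (Fin N) ℝ} (h : IsExactAverage δ q k w) (i : Fin N) (v : Fin N → ℝ)
    (y : ℝ) (hv : ∀ j, k j = q i → v j = y) : ∑ j, w i j * v j = y := by
  have : ∀ j, w i j * v j = w i j * y := by
    intro j
    by_cases hj : k j = q i
    · rw [hv j hj]
    · rw [h.eq_zero i j hj, zero_mul, zero_mul]
  rw [Finset.sum_congr rfl fun j _ => this j, ← Finset.sum_mul, h.sum_eq_one, one_mul]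

/-- A single matching indicator contributes at least `2^{-p}` and the other terms are nonnegative;
with no such indicator the sum is exactly zero. -/
theorem IsExactAverage.roundBits_sum_pos_iff {N m p : ℕ} {q k : Fin N → Fin m → ℝ}
    {w : Matrix (Fin N) (Fin N) ℝ} (h : IsExactAverage (1 / 2 ^ p) q k w) (i : Fin N)
    (v : Fin N → ℝ) (hv : ∀ j, v j = 0 ∨ v j = 1) :
    0 < roundBits p (∑ j, w i j * v j) ↔ ∃ j, k j = q i ∧ v j = 1 := by
  constructor
  · intro hpos
    by_contra! hne
    rw [h.sum_eq i v 0 fun j hj => (hv j).resolve_right (hne j hj), roundBits_zero] at hpos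
    exact lt_irrefl _ hpos
  · rintro ⟨j, hj, hvj⟩
    refine roundBits_pos ((h.lower i j hj).trans ?_)
    refine le_trans (by rw [hvj, mul_one]) (Finset.single_le_sum
      (f := fun j => w i j * v j) (fun j' _ => ?_) (Finset.mem_univ j))
    exact mul_nonneg (h.nonneg i j') (by rcases hv j' with h | h <;> simp [h])

/-! ### Predecessor search in a `B`-ary trie -/

/-- One plus the largest `⌊t / D⌋` below `⌊i / D⌋` among the positions `t` with the same letter as
`i`, and `0` if there is none. -/
def predBlock {N : ℕ} (a : Fin N → ℕ) (D : ℕ) (i : Fin N) : ℕ :=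
  (Finset.univ.filter fun t : Fin N => a t = a i ∧ t.val / D < i.val / D).sup
    fun t => t.val / D + 1

/-- One plus the largest `b < u` in `M`, and `0` if there is none. -/
noncomputable def digitBelow (M : Set ℕ) (u : ℕ) : ℕ :=
  open Classical in ((Finset.range u).filter (· ∈ M)).sup (· + 1)

/-- The predecessor block of one more digit, computed from the predecessor block `c`, the sets `M₁`
and `M₂` of the next digits that occur in the own block `x` and in the predecessor block, and the
own next digit `u`. -/
noncomputable def refineBlock (B x u c : ℕ) (M₁ M₂ : Set ℕ) : ℕ :=
  if 0 < digitBelow M₁ u then x * B + digitBelow M₁ u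
  else if 0 < c then (c - 1) * B + digitBelow M₂ B else 0

theorem le_predBlock {N : ℕ} {a : Fin N → ℕ} {D : ℕ} {i t : Fin N} (h : a t = a i)
    (hlt : t.val / D < i.val / D) : t.val / D + 1 ≤ predBlock a D i :=
  Finset.le_sup (f := fun t : Fin N => t.val / D + 1) (by simp [h, hlt])

theorem exists_of_predBlock_pos {N : ℕ} {a : Fin N → ℕ} {D : ℕ} {i : Fin N}
    (h : 0 < predBlock a D i) :
    ∃ t : Fin N, a t = a i ∧ t.val / D < i.val / D ∧ t.val / D + 1 = predBlock a D i := by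
  have hne : (Finset.univ.filter fun t : Fin N => a t = a i ∧ t.val / D < i.val / D).Nonempty := by
    by_contra hne
    rw [Finset.not_nonempty_iff_eq_empty] at hne
    simp [predBlock, hne] at h
  obtain ⟨t, ht, he⟩ := Finset.exists_mem_eq_sup _ hne fun t : Fin N => t.val / D + 1
  simp only [Finset.mem_filter, Finset.mem_univ, true_and] at ht
  exact ⟨t, ht.1, ht.2, he.symm⟩

theorem le_digitBelow {M : Set ℕ} {u b : ℕ} (hb : b ∈ M) (h : b < u) : b + 1 ≤ digitBelow M u := by
  classical
  exact Finset.le_sup (f := fun b : ℕ => b + 1) (by simp [h, hb])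

theorem exists_of_digitBelow_pos {M : Set ℕ} {u : ℕ} (h : 0 < digitBelow M u) :
    ∃ b ∈ M, b < u ∧ b + 1 = digitBelow M u := by
  classical
  have hne : ((Finset.range u).filter (· ∈ M)).Nonempty := by
    by_contra hne
    rw [Finset.not_nonempty_iff_eq_empty] at hne
    simp [digitBelow, hne] at h
  obtain ⟨b, hb, he⟩ := Finset.exists_mem_eq_sup _ hne fun b : ℕ => b + 1
  simp only [Finset.mem_filter, Finset.mem_range] at hb
  exact ⟨b, hb.2, hb.1, he.symm⟩

theorem predBlock_le {N : ℕ} (a : Fin N → ℕ) (D : ℕ) (i : Fin N) : predBlock a D i ≤ i.val := by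
  refine Finset.sup_le fun t ht => ?_
  simp only [Finset.mem_filter, Finset.mem_univ, true_and] at ht
  exact (Nat.succ_le_of_lt ht.2).trans (Nat.div_le_self _ _)

theorem predBlock_eq_zero {N : ℕ} (a : Fin N → ℕ) {D : ℕ} (h : N ≤ D) (i : Fin N) :
    predBlock a D i = 0 := by
  by_contra hne
  obtain ⟨t, -, ht, -⟩ := exists_of_predBlock_pos (Nat.pos_of_ne_zero hne)
  rw [Nat.div_eq_of_lt (i.isLt.trans_le h)] at ht
  exact Nat.not_lt_zero _ ht

/-- An earlier occurrence in the own coarse block lies after all those in earlier coarse blocks, so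
it wins if there is one. Otherwise the last occurrence sits in the coarse predecessor block, where
any digit is allowed. `h₂` is conditional because without a predecessor block `M₂` is never read. -/
theorem predBlock_eq_refineBlock {N : ℕ} (a : Fin N → ℕ) {B : ℕ} (hB : 0 < B) (D : ℕ) (i : Fin N)
    (M₁ M₂ : Set ℕ)
    (h₁ : ∀ b < B, b ∈ M₁ ↔
      ∃ t : Fin N, a t = a i ∧ t.val / (D * B) = i.val / (D * B) ∧ t.val / D % B = b)
    (h₂ : 0 < predBlock a (D * B) i → ∀ b < B, b ∈ M₂ ↔
      ∃ t : Fin N, a t = a i ∧ t.val / (D * B) = predBlock a (D * B) i - 1 ∧ t.val / D % B = b) :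
    predBlock a D i =
      refineBlock B (i.val / (D * B)) (i.val / D % B) (predBlock a (D * B) i) M₁ M₂ := by
  -- A fine block index is the coarse index followed by one base-`B` digit.
  have hdm : ∀ x : ℕ, x / D = x / (D * B) * B + x / D % B := by
    intro x
    rw [← Nat.div_div_eq_div_mul]
    exact (Nat.div_add_mod' _ _).symm
  have hmod : ∀ x : ℕ, x / D % B < B := fun x => Nat.mod_lt _ hB
  have hstep : ∀ x y : ℕ, x / (D * B) < y / (D * B) → x / (D * B) * B + B ≤ y / (D * B) * B := by
    intro x y h
    rw [← Nat.succ_mul]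
    exact Nat.mul_le_mul_right B h
  refine le_antisymm (Finset.sup_le fun t ht => ?_) ?_
  · simp only [Finset.mem_filter, Finset.mem_univ, true_and] at ht
    obtain ⟨hat, hlt⟩ := ht
    have ht' := hdm t.val
    have hi' := hdm i.val
    have htB := hmod t.val
    have hiB := hmod i.val
    rcases lt_trichotomy (t.val / (D * B)) (i.val / (D * B)) with hq | hq | hq
    · have hs := hstep _ _ hq
      have hc := le_predBlock hat hq
      unfold refineBlock
      split_ifs with hd hc0
      · omega
      -- Either `t` lies in a coarse block before the predecessor block, or in that block itself,
      -- where its digit belongs to `M₂`.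
      · rcases hc.lt_or_eq with hlt' | heq
        · have : t.val / (D * B) * B + B ≤ (predBlock a (D * B) i - 1) * B := by
            rw [← Nat.succ_mul]
            exact Nat.mul_le_mul_right B (by omega)
          omega
        · have hm : t.val / D % B ∈ M₂ := (h₂ hc0 _ htB).2 ⟨t, hat, by omega, rfl⟩
          have := le_digitBelow hm htB
          rw [← heq, Nat.add_sub_cancel]
          omega
      · exact absurd ((Nat.succ_pos _).trans_le hc) hc0
    · have hm : t.val / D % B ∈ M₁ := (h₁ _ htB).2 ⟨t, hat, hq, rfl⟩
      rw [hq] at ht'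
      have := le_digitBelow (u := i.val / D % B) hm (by omega)
      rw [refineBlock, if_pos (by omega)]
      omega
    · have := hstep _ _ hq
      omega
  · unfold refineBlock
    have hi' := hdm i.val
    have hiB := hmod i.val
    split_ifs with hd hc0
    · obtain ⟨b, hb, hbu, he⟩ := exists_of_digitBelow_pos hd
      obtain ⟨t, hat, htq, htb⟩ := (h₁ b (hbu.trans hiB)).1 hb
      have ht' := hdm t.val
      rw [htq] at ht'
      have := le_predBlock (D := D) hat (by omega)
      omega
    · obtain ⟨t₀, hat₀, hlt₀, he₀⟩ := exists_of_predBlock_pos hc0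
      -- The witness of the coarse predecessor block shows that `M₂` contains a digit below `B`.
      have hm : t₀.val / D % B ∈ M₂ := (h₂ hc0 _ (hmod _)).2 ⟨t₀, hat₀, by omega, rfl⟩
      have hd₂ : 0 < digitBelow M₂ B := lt_of_lt_of_le (Nat.succ_pos _) (le_digitBelow hm (hmod _))
      obtain ⟨b, hb, hbu, he⟩ := exists_of_digitBelow_pos hd₂
      obtain ⟨t, hat, htq, htb⟩ := (h₂ hc0 b hbu).1 hb
      have ht' := hdm t.val
      have htq' : t.val / (D * B) < i.val / (D * B) := by omega
      have hs := hstep _ _ htq'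
      have := le_predBlock (D := D) hat (by omega)
      rw [htq] at ht'
      omega
    · exact Nat.zero_le _

/-! ### The induction-heads task in terms of predecessors -/

theorem letterAt_succ {S : Type*} {N : ℕ} (w : Fin N → S) (t : Fin N) :
    letterAt w (t.val + 1) = some (w t) := by
  have := t.isLt
  simp [letterAt]

theorem letterAt_eq_some {S : Type*} {N : ℕ} {w : Fin N → S} {t : ℕ} {x : S}
    (h : letterAt w t = some x) : ∃ u : Fin N, u.val + 1 = t ∧ w u = x := by
  unfold letterAt at h
  split_ifs at h with ht
  exact ⟨⟨t - 1, by omega⟩, by simp; omega, by simpa using h⟩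

/-- The shift by one built into `predBlock` makes its value for `D = 1` the 0-based index of the
position after the predecessor, so the 1-based `σ` is that value plus one. The value `0` stays free
to mean `⊥`, as position `0` follows nothing. -/
theorem inductionHead_eq {S : Type*} {N : ℕ} (w : Fin N → S) (a : Fin N → ℕ)
    (ha : ∀ s t, a s = a t ↔ w s = w t) (i : Fin N) :
    inductionHead w i = if 0 < predBlock a 1 i then
      some (w ⟨predBlock a 1 i, (predBlock_le a 1 i).trans_lt i.isLt⟩) else none := by
  split_ifs with h
  · have hs : sigmaIdx w (i.val + 1) = predBlock a 1 i + 1 := by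
      refine IsGreatest.csSup_eq ⟨?_, ?_⟩
      · obtain ⟨t, hat, hlt, he⟩ := exists_of_predBlock_pos h
        simp only [Nat.div_one] at hlt he
        refine Or.inr ⟨by omega, ?_⟩
        rw [← he, Nat.add_sub_cancel, letterAt_succ, letterAt_succ, (ha t i).1 hat]
      · rintro j (hj | ⟨hj, he⟩)
        · rw [Set.mem_singleton_iff.1 hj]
          exact Nat.zero_le _
        · rw [letterAt_succ] at he
          obtain ⟨u, hu, hw⟩ := letterAt_eq_some he
          have := le_predBlock (D := 1) ((ha u i).2 hw) (by simp only [Nat.div_one]; omega)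
          simp only [Nat.div_one] at this
          omega
    rw [inductionHead, hs]
    exact letterAt_succ w ⟨predBlock a 1 i, _⟩
  · have hs : sigmaIdx w (i.val + 1) = 0 := by
      refine IsGreatest.csSup_eq ⟨Or.inl rfl, ?_⟩
      rintro j (hj | ⟨hj, he⟩)
      · exact (Set.mem_singleton_iff.1 hj).le
      · rw [letterAt_succ] at he
        obtain ⟨u, hu, hw⟩ := letterAt_eq_some he
        have := le_predBlock (D := 1) ((ha u i).2 hw) (by simp only [Nat.div_one]; omega)
        omega
    rw [inductionHead, hs]
    simp [letterAt]

/-! ### The transformer -/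

/-- What a row knows: its letter, its 0-based position, and its predecessor block. -/
structure Token where
  letter : ℕ
  pos : ℕ
  pred : ℕ

/-- The coordinate with index `t`, and `0` outside of the range of indices. -/
def coord {d : ℕ} (x : Fin d → ℝ) (t : ℕ) : ℝ := if h : t < d then x ⟨t, h⟩ else 0

/-- The token of a row at the start of layer `s`; the rows produced by the earlier layers hold the
letter, the position, the predecessor block of the previous level, and two digit sets. -/
noncomputable def decodeToken (B k : ℕ) {d : ℕ} : ℕ → (Fin d → ℝ) → Token
  | 0, x => ⟨⌊coord x 0⌋₊, ⌊coord x 1⌋₊ - 1, 0⟩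
  | s + 1, x => ⟨⌊coord x 0⌋₊, ⌊coord x 1⌋₊ - 1,
      refineBlock B ((⌊coord x 1⌋₊ - 1) / (B ^ (k - (s + 1)) * B))
        ((⌊coord x 1⌋₊ - 1) / B ^ (k - (s + 1)) % B) ⌊coord x 2⌋₊
        {b | 0 < coord x (3 + b)} {b | 0 < coord x (3 + B + b)}⟩

/-- The address that a token looks up in head `h` of layer `s`. -/
def queryAddr (B k s : ℕ) (h : Fin 3) (τ : Token) : ℕ × ℕ :=
  if h = 0 then (τ.pos, 0)
  else if s < k then
    (τ.letter, if h = 2 ∧ 0 < τ.pred then τ.pred - 1 else τ.pos / B ^ (k - s))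
  else (if 0 < τ.pred then τ.pred else τ.pos, 0)

/-- The address at which a token is found in head `h` of layer `s`. -/
def keyAddr (B k s : ℕ) (h : Fin 3) (τ : Token) : ℕ × ℕ :=
  if h = 0 then (τ.pos, 0)
  else if s < k then (τ.letter, τ.pos / B ^ (k - s))
  else (τ.pos, 0)

/-- The coordinates of the value of a token in head `h` of layer `s`. -/
def tokenValue (B k s : ℕ) (h : Fin 3) (τ : Token) (t : ℕ) : ℕ :=
  if h = 0 then
    if t = 0 then τ.letter else if t = 1 then τ.pos + 1 else if t = 2 then τ.pred else 0
  else if s < k then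
    if t = 3 + (if h = 1 then 0 else B) + τ.pos / B ^ (k - (s + 1)) % B then 1 else 0
  else if h = 1 ∧ t = 3 then τ.letter else 0

/-- An address as a row. -/
def addrRow {d : ℕ} (x : ℕ × ℕ) : Fin d → ℝ :=
  fun t => ((if t.val = 0 then x.1 else if t.val = 1 then x.2 else 0 : ℕ) : ℝ)

/-- The transformer that performs predecessor search in the `B`-ary trie of depth `k`. -/
noncomputable def trieTransformer (B k d p : ℕ) : Transformer (k + 1) 3 d d where
  head s h :=
    { Q := quantize p fun x => addrRow (queryAddr B k s h (decodeToken B k s x))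
      K := quantize p fun x => addrRow (keyAddr B k s h (decodeToken B k s x))
      V := quantize p fun x t => (tokenValue B k s h (decodeToken B k s x) t : ℝ)
      W := 1 }
  out := quantize p fun x t =>
    if t.val = 0 then if 0 < ⌊coord x 2⌋₊ then coord x 3 else 0 else 0

theorem hasPrecision_trieTransformer (B k d p : ℕ) :
    (trieTransformer B k d p).HasPrecision p := by
  simp only [Transformer.HasPrecision, trieTransformer, hasBitPrecision_quantize, true_and,
    and_true]
  intro s h a b
  rw [Matrix.one_apply]
  split_ifs
  · rw [← Nat.cast_one]
    exact natCast_mem_fixedPoint Nat.one_le_two_pow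
  · rw [← Nat.cast_zero]
    exact natCast_mem_fixedPoint (Nat.zero_le _)

/-- The token of position `i` at the start of layer `s`. -/
def trueToken {N : ℕ} (a : Fin N → ℕ) (B k s : ℕ) (i : Fin N) : Token :=
  ⟨a i, i, predBlock a (B ^ (k - s)) i⟩

/-- The queries of head `h` of layer `s`. -/
def trueQuery {N : ℕ} (a : Fin N → ℕ) (B k d s : ℕ) (h : Fin 3) (i : Fin N) : Fin d → ℝ :=
  addrRow (queryAddr B k s h (trueToken a B k s i))

/-- The keys of head `h` of layer `s`. -/
def trueKey {N : ℕ} (a : Fin N → ℕ) (B k d s : ℕ) (h : Fin 3) (i : Fin N) : Fin d → ℝ :=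
  addrRow (keyAddr B k s h (trueToken a B k s i))

/-- Equality of rows thus means equality of addresses, so a head is a lookup by key. -/
theorem addrRow_injective {d : ℕ} (hd : 2 ≤ d) :
    Function.Injective (addrRow : ℕ × ℕ → Fin d → ℝ) := by
  intro x y h
  have h0 := congrFun h ⟨0, by omega⟩
  have h1 := congrFun h ⟨1, by omega⟩
  simp only [addrRow, if_true, Nat.cast_inj, one_ne_zero, if_false] at h0 h1
  exact Prod.ext h0 h1

theorem addrRow_mem_fixedPoint {d p : ℕ} {x : ℕ × ℕ} (h₁ : x.1 ≤ 2 ^ p) (h₂ : x.2 ≤ 2 ^ p)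
    (t : Fin d) : addrRow x t ∈ fixedPoint p := by
  refine natCast_mem_fixedPoint ?_
  split_ifs
  · exact h₁
  · exact h₂
  · exact Nat.zero_le _

/-! ### One layer of the trie descent -/

section

variable {N : ℕ} {a : Fin N → ℕ} {B k d p s : ℕ}

theorem trueQuery_mem_fixedPoint (ha : ∀ i, a i ≤ 2 ^ p) (hN : N ≤ 2 ^ p) (h : Fin 3) (i : Fin N)
    (t : Fin d) : trueQuery a B k d s h i t ∈ fixedPoint p := by
  have hi := i.isLt
  have hp := predBlock_le a (B ^ (k - s)) i
  have hq : i.val / B ^ (k - s) ≤ i := Nat.div_le_self _ _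
  have hai := ha i
  refine addrRow_mem_fixedPoint ?_ ?_ t <;> unfold queryAddr trueToken <;> split_ifs <;>
    (try simp only) <;> omega

theorem trueKey_mem_fixedPoint (ha : ∀ i, a i ≤ 2 ^ p) (hN : N ≤ 2 ^ p) (h : Fin 3) (i : Fin N)
    (t : Fin d) : trueKey a B k d s h i t ∈ fixedPoint p := by
  have hi := i.isLt
  have hq : i.val / B ^ (k - s) ≤ i := Nat.div_le_self _ _
  have hai := ha i
  refine addrRow_mem_fixedPoint ?_ ?_ t <;> unfold keyAddr trueToken <;> split_ifs <;>
    (try simp only) <;> omega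

theorem tokenValue_le (ha : ∀ i, a i ≤ 2 ^ p) (hN : N ≤ 2 ^ p) (h : Fin 3) (i : Fin N) (t : ℕ) :
    tokenValue B k s h (trueToken a B k s i) t ≤ 2 ^ p := by
  have hi := i.isLt
  have hp := predBlock_le a (B ^ (k - s)) i
  have hai := ha i
  have h2 : 1 ≤ 2 ^ p := Nat.one_le_two_pow
  unfold tokenValue trueToken
  split_ifs <;> (try simp only) <;> omega

/-- Every query has a matching key. -/
theorem exists_trueKey_eq_trueQuery (h : Fin 3) (i : Fin N) :
    ∃ j, trueKey a B k d s h j = trueQuery a B k d s h i := by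
  suffices ∃ j, keyAddr B k s h (trueToken a B k s j) = queryAddr B k s h (trueToken a B k s i) from
    this.imp fun j hj => congrArg addrRow hj
  unfold keyAddr queryAddr
  split_ifs with h0 hs hp hp
  · exact ⟨i, rfl⟩
  -- The occurrence that defines the predecessor block is itself stored under the queried address.
  -- In the next case the query falls back on the own block, where the row matches itself.
  · obtain ⟨t, hat, -, he⟩ := exists_of_predBlock_pos hp.2
    refine ⟨t, Prod.ext hat ?_⟩
    have hpos := hp.2
    simp only [trueToken] at hpos ⊢
    omega
  · exact ⟨i, rfl⟩
  · exact ⟨⟨predBlock a (B ^ (k - s)) i, (predBlock_le _ _ i).trans_lt i.isLt⟩, rfl⟩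
  · exact ⟨i, rfl⟩

/-- The output of a layer whose input encodes the tokens. -/
theorem sum_apply_trieTransformer (ha : ∀ i, a i ≤ 2 ^ p) (hN : N ≤ 2 ^ p) (hs : s < k + 1)
    (A : Fin 3 → WeightRule N d) (X : Matrix (Fin N) (Fin d) ℝ)
    (hX : ∀ i, decodeToken B k s (fun t => roundBits p (X i t)) = trueToken a B k s i)
    (i : Fin N) (t : Fin d) :
    (∑ h, ((trieTransformer B k d p).head ⟨s, hs⟩ h).apply (A h) X) i t =
      ∑ h, ∑ j, A h (trueQuery a B k d s h) (trueKey a B k d s h) i j *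
        (tokenValue B k s h (trueToken a B k s j) t : ℝ) := by
  rw [Matrix.sum_apply]
  refine Finset.sum_congr rfl fun h _ => ?_
  have hQ : (fun i => ((trieTransformer B k d p).head ⟨s, hs⟩ h).Q (X i)) =
      trueQuery a B k d s h := by
    funext i t
    simp only [trieTransformer, quantize, hX]
    exact roundBits_of_mem_fixedPoint (trueQuery_mem_fixedPoint ha hN h i t)
  have hK : (fun i => ((trieTransformer B k d p).head ⟨s, hs⟩ h).K (X i)) =
      trueKey a B k d s h := by
    funext i t
    simp only [trieTransformer, quantize, hX]
    exact roundBits_of_mem_fixedPoint (trueKey_mem_fixedPoint ha hN h i t)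
  have hV : ∀ j, ((trieTransformer B k d p).head ⟨s, hs⟩ h).V (X j) t =
      (tokenValue B k s h (trueToken a B k s j) t : ℝ) := by
    intro j
    simp only [trieTransformer, quantize, hX]
    exact roundBits_natCast (tokenValue_le ha hN h j t)
  have hW : ((trieTransformer B k d p).head ⟨s, hs⟩ h).W = 1 := rfl
  rw [AttnHead.apply, hQ, hK, hW, Matrix.mul_one, Matrix.mul_apply]
  exact Finset.sum_congr rfl fun j _ => by rw [Matrix.of_apply, hV]

theorem coord_round (x : Fin d → ℝ) (t : ℕ) :
    coord (fun u => roundBits p (x u)) t = roundBits p (coord x t) := by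
  unfold coord
  split_ifs
  · rfl
  · exact (roundBits_zero p).symm

theorem coord_eq {x : Fin d → ℝ} {f : ℕ → ℝ} (hx : ∀ t : Fin d, x t = f t) {t : ℕ} (ht : t < d) :
    coord x t = f t := by
  rw [coord, dif_pos ht, hx]

variable {w : Fin 3 → Matrix (Fin N) (Fin N) ℝ}

/-- Heads 1 and 2 write only from coordinate `3` on, so summing the heads leaves the copy of the
token intact. -/
theorem tokenValue_eq_zero {h : Fin 3} (hh : h ≠ 0) {t : ℕ} (ht : t < 3) (τ : Token) :
    tokenValue B k s h τ t = 0 := by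
  rw [tokenValue, if_neg hh]
  by_cases hs : s < k
  · rw [if_pos hs, if_neg (by omega)]
  · rw [if_neg hs, if_neg (by omega)]

/-- The first three coordinates are copied by head `0`. -/
theorem sum_tokenValue_of_lt_three (hd : 2 ≤ d)
    (hw : ∀ h, IsExactAverage (1 / 2 ^ p) (trueQuery a B k d s h) (trueKey a B k d s h) (w h))
    (i : Fin N) {t : ℕ} (ht : t < 3) :
    ∑ h, ∑ j, w h i j * (tokenValue B k s h (trueToken a B k s j) t : ℝ) =
      tokenValue B k s 0 (trueToken a B k s i) t := by
  have h0 : ∑ j, w 0 i j * (tokenValue B k s 0 (trueToken a B k s j) t : ℝ) =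
      tokenValue B k s 0 (trueToken a B k s i) t := by
    refine (hw 0).sum_eq i _ _ fun j hj => ?_
    have hij := addrRow_injective hd hj
    simp only [keyAddr, queryAddr, if_true, trueToken, Prod.mk.injEq, and_true] at hij
    rw [Fin.ext hij]
  rw [Fin.sum_univ_three, h0]
  simp [tokenValue_eq_zero one_ne_zero ht, tokenValue_eq_zero (show (2 : Fin 3) ≠ 0 by decide) ht]

/-- The digits found by head `1`. -/
theorem roundBits_sum_tokenValue_own (hd : 2 ≤ d) (hs : s < k)
    (hw : ∀ h, IsExactAverage (1 / 2 ^ p) (trueQuery a B k d s h) (trueKey a B k d s h) (w h))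
    (i : Fin N) {b : ℕ} (hb : b < B) :
    0 < roundBits p (∑ h, ∑ j, w h i j *
        (tokenValue B k s h (trueToken a B k s j) (3 + b) : ℝ)) ↔
      ∃ t : Fin N, a t = a i ∧ t.val / B ^ (k - s) = i.val / B ^ (k - s) ∧
        t.val / B ^ (k - (s + 1)) % B = b := by
  have hv : ∀ j : Fin N, tokenValue B k s 1 (trueToken a B k s j) (3 + b) =
      if j.val / B ^ (k - (s + 1)) % B = b then 1 else 0 := by
    intro j
    simp [tokenValue, trueToken, hs, eq_comm]
  -- Among the coordinates `3, …, 2 + B` only head 1 writes: head 0 stops before them and head 2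
  -- starts after them.
  rw [Fin.sum_univ_three, (hw 0).sum_eq i _ 0 fun j _ => ?_, (hw 2).sum_eq i _ 0 fun j _ => ?_,
    add_zero, zero_add, (hw 1).roundBits_sum_pos_iff i _ fun j => ?_]
  · refine exists_congr fun j => ?_
    rw [hv, trueKey, trueQuery, (addrRow_injective hd).eq_iff]
    simp [keyAddr, queryAddr, trueToken, hs, and_assoc]
  · rw [hv]
    split_ifs <;> simp
  · have : ¬ 3 + b = 3 + B + j.val / B ^ (k - (s + 1)) % B := by omega
    simp [tokenValue, trueToken, hs, this]
  · have h1 : ¬ 3 + b = 1 := by omega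
    have h2 : ¬ 3 + b = 2 := by omega
    simp [tokenValue, h1, h2]

/-- The digits found by head `2`. -/
theorem roundBits_sum_tokenValue_pred (hd : 2 ≤ d) (hB : 0 < B) (hs : s < k)
    (hw : ∀ h, IsExactAverage (1 / 2 ^ p) (trueQuery a B k d s h) (trueKey a B k d s h) (w h))
    (i : Fin N) (hpos : 0 < predBlock a (B ^ (k - s)) i) {b : ℕ} :
    0 < roundBits p (∑ h, ∑ j, w h i j *
        (tokenValue B k s h (trueToken a B k s j) (3 + B + b) : ℝ)) ↔
      ∃ t : Fin N, a t = a i ∧ t.val / B ^ (k - s) = predBlock a (B ^ (k - s)) i - 1 ∧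
        t.val / B ^ (k - (s + 1)) % B = b := by
  have hv : ∀ j : Fin N, tokenValue B k s 2 (trueToken a B k s j) (3 + B + b) =
      if j.val / B ^ (k - (s + 1)) % B = b then 1 else 0 := by
    intro j
    simp [tokenValue, trueToken, hs, eq_comm]
  rw [Fin.sum_univ_three, (hw 0).sum_eq i _ 0 fun j _ => ?_, (hw 1).sum_eq i _ 0 fun j _ => ?_,
    add_zero, zero_add, (hw 2).roundBits_sum_pos_iff i _ fun j => ?_]
  · refine exists_congr fun j => ?_
    rw [hv, trueKey, trueQuery, (addrRow_injective hd).eq_iff]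
    simp [keyAddr, queryAddr, trueToken, hs, hpos, and_assoc]
  · rw [hv]
    split_ifs <;> simp
  -- Digits are below `B`, so head 1 cannot reach the range of head 2.
  · have : ¬ 3 + B + b = 3 + j.val / B ^ (k - (s + 1)) % B := by
      have := Nat.mod_lt (j.val / B ^ (k - (s + 1))) hB
      omega
    simp [tokenValue, trueToken, hs, this]
  · have h1 : ¬ 3 + B + b = 1 := by omega
    have h2 : ¬ 3 + B + b = 2 := by omega
    simp [tokenValue, h1, h2]

/-- A layer before the last one refines the predecessor blocks. -/
theorem decodeToken_succ (hd : d = 3 + 2 * B) (hB : 0 < B) (hs : s < k) (ha : ∀ i, a i ≤ 2 ^ p)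
    (hN : N ≤ 2 ^ p)
    (hw : ∀ h, IsExactAverage (1 / 2 ^ p) (trueQuery a B k d s h) (trueKey a B k d s h) (w h))
    (i : Fin N) (x : Fin d → ℝ)
    (hx : ∀ t : Fin d, x t =
      ∑ h, ∑ j, w h i j * (tokenValue B k s h (trueToken a B k s j) t : ℝ)) :
    decodeToken B k (s + 1) (fun t => roundBits p (x t)) = trueToken a B k (s + 1) i := by
  have hlow : ∀ t < 3, ⌊coord (fun t => roundBits p (x t)) t⌋₊ =
      tokenValue B k s 0 (trueToken a B k s i) t := by
    intro t ht
    rw [coord_round, coord_eq (f := fun t => ∑ h, ∑ j, w h i j *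
      (tokenValue B k s h (trueToken a B k s j) t : ℝ)) hx (by omega),
      sum_tokenValue_of_lt_three (by omega) hw i ht, roundBits_natCast (tokenValue_le ha hN _ _ _),
      Nat.floor_natCast]
  have h0 := hlow 0 (by omega)
  have h1 := hlow 1 (by omega)
  have h2 := hlow 2 (by omega)
  simp only [tokenValue, trueToken, if_true, one_ne_zero, if_false, OfNat.ofNat_ne_zero,
    OfNat.ofNat_ne_one] at h0 h1 h2
  -- The truncated subtraction is harmless because `s < k`.
  have hD : B ^ (k - (s + 1)) * B = B ^ (k - s) := by
    rw [← pow_succ]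
    congr 1
    omega
  simp only [decodeToken, h0, h1, h2, Nat.add_sub_cancel, trueToken, Token.mk.injEq, true_and]
  rw [← hD]
  refine (predBlock_eq_refineBlock a hB _ i _ _ (fun b hb => ?_) fun hpos b hb => ?_).symm
  · rw [Set.mem_ofPred_eq, coord_round, coord_eq (f := fun t => ∑ h, ∑ j, w h i j *
      (tokenValue B k s h (trueToken a B k s j) t : ℝ)) hx (by omega), hD]
    exact roundBits_sum_tokenValue_own (by omega) hs hw i hb
  · rw [hD] at hpos ⊢
    rw [Set.mem_ofPred_eq, coord_round, coord_eq (f := fun t => ∑ h, ∑ j, w h i j *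
      (tokenValue B k s h (trueToken a B k s j) t : ℝ)) hx (by omega)]
    exact roundBits_sum_tokenValue_pred (by omega) hB hs hw i hpos

/-- The last layer fetches the letter after the predecessor. -/
theorem sum_tokenValue_last (hd : 2 ≤ d)
    (hw : ∀ h, IsExactAverage (1 / 2 ^ p) (trueQuery a B k d k h) (trueKey a B k d k h) (w h))
    (i : Fin N) (hpos : 0 < predBlock a 1 i) :
    ∑ h, ∑ j, w h i j * (tokenValue B k k h (trueToken a B k k j) 3 : ℝ) =
      a ⟨predBlock a 1 i, (predBlock_le a 1 i).trans_lt i.isLt⟩ := by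
  have h1 : ∑ j, w 1 i j * (tokenValue B k k 1 (trueToken a B k k j) 3 : ℝ) =
      a ⟨predBlock a 1 i, (predBlock_le a 1 i).trans_lt i.isLt⟩ := by
    refine (hw 1).sum_eq i _ _ fun j hj => ?_
    have hij := addrRow_injective hd hj
    -- In layer `k` blocks have length `B ^ 0 = 1`, so the predecessor value is directly a position
    -- to look up.
    simp [keyAddr, queryAddr, trueToken, hpos] at hij
    have hval : tokenValue B k k 1 (trueToken a B k k j) 3 = a j := by simp [tokenValue, trueToken]
    rw [hval]
    congr 2
    exact Fin.ext hij
  rw [Fin.sum_univ_three, h1]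
  simp [tokenValue]

end

/-- With weights that average over exact matches, the transformer solves the induction-heads task. -/
theorem eval_trieTransformer {N n B k d p : ℕ} {S : Type*} (e : S ≃ Fin n) (w : Fin N → S)
    (hd : d = 3 + 2 * B) (hB : 0 < B) (hn : n ≤ 2 ^ p) (hN : N ≤ 2 ^ p) (hk : N ≤ B ^ k)
    (A : Fin (k + 1) → Fin 3 → WeightRule N d)
    (hA : ∀ (s : Fin (k + 1)) (h : Fin 3), IsExactAverage (1 / 2 ^ p)
      (trueQuery (fun i => (e (w i)).val + 1) B k d s h)
      (trueKey (fun i => (e (w i)).val + 1) B k d s h)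
      (A s h (trueQuery (fun i => (e (w i)).val + 1) B k d s h)
        (trueKey (fun i => (e (w i)).val + 1) B k d s h))) :
    (trieTransformer B k d p).eval A (inputRows e d w) = solutionRows e d w := by
  set a : Fin N → ℕ := fun i => (e (w i)).val + 1 with hadef
  have ha : ∀ i, a i ≤ 2 ^ p := fun i => (Nat.succ_le_of_lt (e (w i)).isLt).trans hn
  have hd2 : 2 ≤ d := by omega
  have hstate : ∀ s (hs : s < k + 1), (∀ i, decodeToken B k s
      (fun t => roundBits p ((trieTransformer B k d p).state A (inputRows e d w) s i t)) =
      trueToken a B k s i) → ∀ i t,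
      (trieTransformer B k d p).state A (inputRows e d w) (s + 1) i t =
      ∑ h, ∑ j, A ⟨s, hs⟩ h (trueQuery a B k d s h) (trueKey a B k d s h) i j *
        (tokenValue B k s h (trueToken a B k s j) t : ℝ) := by
    intro s hs hX i t
    rw [Transformer.state, dif_pos hs]
    exact sum_apply_trieTransformer ha hN hs (A ⟨s, hs⟩) _ hX i t
  -- Invariant: decoding the rounded rows gives the true tokens. At `s = 0` the predecessor default
  -- `0` is right since `N ≤ B ^ k`.
  have hinv : ∀ s ≤ k, ∀ i, decodeToken B k s
      (fun t => roundBits p ((trieTransformer B k d p).state A (inputRows e d w) s i t)) =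
      trueToken a B k s i := by
    intro s
    induction s with
    | zero =>
      intro _ i
      have hi : i.val + 1 ≤ 2 ^ p := (Nat.succ_le_of_lt i.isLt).trans hN
      have h0 : (inputRows e d w) i ⟨0, by omega⟩ = (a i : ℝ) := by
        simp [inputRows, letterCode, hadef]
      have h1 : (inputRows e d w) i ⟨1, by omega⟩ = ((i.val + 1 : ℕ) : ℝ) := by
        simp [inputRows]
      simp only [decodeToken, Transformer.state, trueToken, coord_round]
      simp only [coord, dif_pos (show 0 < d by omega), dif_pos (show 1 < d by omega), h0, h1,
        roundBits_natCast (ha i), roundBits_natCast hi, Nat.floor_natCast, Nat.add_sub_cancel,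
        Nat.sub_zero, predBlock_eq_zero a hk i]
    | succ s ih =>
      intro hs i
      exact decodeToken_succ hd hB (by omega) ha hN (fun h => hA ⟨s, by omega⟩ h) i _
        (hstate s (by omega) (ih (by omega)) i)
  have hfin := hstate k (by omega) (hinv k le_rfl)
  have hA' := hA ⟨k, by omega⟩
  ext i t
  have hpred : (⌊roundBits p (coord ((trieTransformer B k d p).state A (inputRows e d w) (k + 1) i)
      2)⌋₊) = predBlock a 1 i := by
    rw [coord_eq (f := fun t => ∑ h, ∑ j, A ⟨k, by omega⟩ h (trueQuery a B k d k h)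
        (trueKey a B k d k h) i j * (tokenValue B k k h (trueToken a B k k j) t : ℝ))
        (hfin i) (t := 2) (by omega), sum_tokenValue_of_lt_three hd2 hA' i (by omega),
      roundBits_natCast (tokenValue_le ha hN _ _ _), Nat.floor_natCast]
    simp [tokenValue, trueToken]
  have hout : ∀ x t, (trieTransformer B k d p).out x t = roundBits p (if t.val = 0 then
      if 0 < ⌊roundBits p (coord x 2)⌋₊ then roundBits p (coord x 3) else 0 else 0) := by
    intro x t
    simp only [trieTransformer, quantize, coord_round]
  rw [Transformer.eval, Matrix.of_apply, hout, hpred, solutionRows, Matrix.of_apply,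
    inductionHead_eq w a fun s t => by simp [hadef, Fin.val_inj]]
  split_ifs with ht hpos
  · rw [coord_eq (f := fun t => ∑ h, ∑ j, A ⟨k, by omega⟩ h (trueQuery a B k d k h)
        (trueKey a B k d k h) i j * (tokenValue B k k h (trueToken a B k k j) t : ℝ))
        (hfin i) (t := 3) (by omega), sum_tokenValue_last hd2 hA' i hpos,
      roundBits_natCast (ha _), roundBits_natCast (ha _)]
    simp [letterCode, hadef]
  · exact roundBits_zero p
  · exact roundBits_zero p

/-! ### Sizes -/

/-- `(K + 2) * N ^ (K + 2)` dominates all that must fit: positions, letters up to `K * N`, and `N *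
ℓ ≤ K * N ^ (K + 1)`. The bound on `p` uses `log 2 > 1/2`. -/
theorem exists_precision (K : ℕ) {N : ℕ} (hN : 1 ≤ N) :
    ∃ p : ℕ, (K + 2) * N ^ (K + 2) ≤ 2 ^ p ∧
      (p : ℝ) ≤ (4 * K + 8) * (1 + Real.log N) := by
  refine ⟨(K + 2) * (Nat.log 2 N + 1) + (K + 2), ?_, ?_⟩
  · rw [pow_add 2, pow_mul' 2, mul_comm]
    exact Nat.mul_le_mul (Nat.pow_le_pow_left (Nat.lt_pow_succ_log_self one_lt_two N).le _)
      Nat.lt_two_pow_self.le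
  · have hN' : (1 : ℝ) ≤ N := by exact_mod_cast hN
    have hlog : 0 ≤ Real.log N := Real.log_nonneg hN'
    have h1 : (Nat.log 2 N : ℝ) ≤ 2 * Real.log N := by
      have h2 : ((2 : ℝ) ^ Nat.log 2 N) ≤ N := by
        exact_mod_cast Nat.pow_log_le_self 2 (by omega)
      have h3 := Real.log_le_log (by positivity) h2
      rw [Real.log_pow] at h3
      nlinarith [Real.log_two_gt_d9, Nat.cast_nonneg (α := ℝ) (Nat.log 2 N)]
    push_cast
    nlinarith [Nat.cast_nonneg (α := ℝ) K, mul_nonneg (Nat.cast_nonneg (α := ℝ) K) hlog,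
      mul_le_mul_of_nonneg_left h1 (Nat.cast_nonneg (α := ℝ) K)]

theorem isExactAverage_of_isANNAWeights_trueQuery {N B k d p s : ℕ} {a : Fin N → ℕ}
    (ha : ∀ i, a i ≤ 2 ^ p) (hN : N ≤ 2 ^ p) (h : Fin 3) {r c ℓ : ℝ} (hr : 0 ≤ r) (hc : 1 ≤ c)
    (hcr : c * r < 1 / 2 ^ p) (hl : 1 ≤ ℓ) (hNl : N * ℓ ≤ 2 ^ p) {w : Matrix (Fin N) (Fin N) ℝ}
    (hw : IsANNAWeights r c ℓ (trueQuery a B k d s h) (trueKey a B k d s h) w) :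
    IsExactAverage (1 / 2 ^ p) (trueQuery a B k d s h) (trueKey a B k d s h) w :=
  hw.isExactAverage (trueQuery_mem_fixedPoint ha hN h) (trueKey_mem_fixedPoint ha hN h) hr hc hcr
    hl hNl

/-! ### Choice of parameters and the union bound -/

theorem theorem5p2 :
    ∃ C₀ : ℝ, ∀ ε ε' : ℝ, 0 < ε → ε < ε' → ε' < 1 → ∀ K : ℕ,
      ∃ C : ℝ, ∀ N : ℕ, 1 ≤ N → ∀ (S : Type*) (n : ℕ) (e : S ≃ Fin n), n ≤ K * N →
        ∃ (L H d m p : ℕ) (T : Transformer L H d m),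
          (L : ℝ) ≤ C₀ / (ε * (ε' - ε) ^ 2) ∧
          (H : ℝ) ≤ C * (N : ℝ) ^ ((ε' - ε) / 4) ∧
          (m : ℝ) ≤ C * (N : ℝ) ^ ε' ∧
          2 ≤ d ∧ (d : ℝ) ≤ C * (N : ℝ) ^ ε' ∧
          (p : ℝ) ≤ C * (1 + Real.log N) ∧ T.HasPrecision p ∧
          -- with exact-match attention in every head
          (∀ w : Fin N → S,
            T.eval (fun _ _ => exactMatch N m) (inputRows e d w) = solutionRows e d w) ∧
          -- with arbitrary ANNA mechanisms in the heads, for suitable `r` and arbitrarily large `c`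
          ∃ r₀ : ℝ, 0 < r₀ ∧
            ∀ r c ℓ : ℝ, 0 ≤ r → 1 ≤ c → c * r ≤ r₀ → 1 ≤ ℓ → ℓ ≤ K * (N : ℝ) ^ K →
            ∀ (η : ℝ≥0∞) (Ω : Type*) [MeasurableSpace Ω] (μ : MeasureTheory.Measure Ω)
              [MeasureTheory.IsProbabilityMeasure μ] (A : Fin L → Fin H → Ω → WeightRule N m),
              (∀ l h, IsANNAMechanism μ r c ℓ η (A l h)) →
              ∀ w : Fin N → S,
                μ {ω | T.eval (fun l h => A l h ω) (inputRows e d w) ≠ solutionRows e d w} ≤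
                  (L : ℝ≥0∞) * (H : ℝ≥0∞) * η := by
  -- `3` comes from `k + 1 < 1/ε' + 2 ≤ 3/ε`; `4 * K + 8` is dictated by the precision and exceeds
  -- the `7` needed for the width.
  refine ⟨3, fun ε ε' hε hεε' hε' K => ⟨4 * K + 8, fun N hN S n e hn => ?_⟩⟩
  have hε'0 : 0 < ε' := hε.trans hεε'
  have hK0 : (0 : ℝ) ≤ K := Nat.cast_nonneg K
  have hN1 : (1 : ℝ) ≤ N := by exact_mod_cast hN
  have hpow : ∀ x : ℝ, 0 ≤ x → (1 : ℝ) ≤ (N : ℝ) ^ x := fun x hx => Real.one_le_rpow hN1 hx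
  obtain ⟨p, hp, hpC⟩ := exists_precision K hN
  have hNpow : ∀ j, 1 ≤ N ^ j := fun j => Nat.one_le_pow _ _ hN
  have hNp : N ≤ 2 ^ p := by
    refine le_trans ?_ hp
    calc N = 1 * N ^ 1 := by simp
      _ ≤ _ := Nat.mul_le_mul (by omega) (Nat.pow_le_pow_right hN (by omega))
  have hnp : n ≤ 2 ^ p := by
    refine hn.trans (le_trans ?_ hp)
    calc K * N = K * N ^ 1 := by simp
      _ ≤ _ := Nat.mul_le_mul (by omega) (Nat.pow_le_pow_right hN (by omega))
  set B := ⌈(N : ℝ) ^ ε'⌉₊ with hBdef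
  set k := ⌈1 / ε'⌉₊ with hkdef
  have hB : 0 < B := Nat.ceil_pos.2 (zero_lt_one.trans_le (hpow ε' hε'0.le))
  have hBle : (B : ℝ) ≤ 2 * (N : ℝ) ^ ε' := by
    have := Nat.ceil_lt_add_one (zero_le_one.trans (hpow ε' hε'0.le))
    linarith [hpow ε' hε'0.le]
  have hk : N ≤ B ^ k := by
    have h1 : (N : ℝ) ≤ (B : ℝ) ^ k := by
      calc (N : ℝ) = (N : ℝ) ^ (1 : ℝ) := (Real.rpow_one _).symm
        _ ≤ (N : ℝ) ^ (ε' * k) := by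
            refine Real.rpow_le_rpow_of_exponent_le hN1 ?_
            rw [← div_le_iff₀' hε'0]
            exact Nat.le_ceil _
        _ = ((N : ℝ) ^ ε') ^ k := Real.rpow_mul_natCast (by positivity) _ _
        _ ≤ (B : ℝ) ^ k := by
            gcongr
            exact Nat.le_ceil _
    exact_mod_cast h1
  have hdC : ((3 + 2 * B : ℕ) : ℝ) ≤ (4 * K + 8) * (N : ℝ) ^ ε' := by
    push_cast
    nlinarith [hpow ε' hε'0.le]
  have hL : ((k + 1 : ℕ) : ℝ) ≤ 3 / (ε * (ε' - ε) ^ 2) := by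
    have h1 : (k : ℝ) < 1 / ε' + 1 := Nat.ceil_lt_add_one (by positivity)
    have h2 : 1 / ε' ≤ 1 / ε := one_div_le_one_div_of_le hε hεε'.le
    have h3 : 1 ≤ 1 / ε := by rw [le_div_iff₀ hε]; linarith
    -- The factor `(ε' - ε)^2 ≤ 1` is pure slack.
    have h4 : 3 / ε ≤ 3 / (ε * (ε' - ε) ^ 2) := by
      have h5 : 0 < ε' - ε := sub_pos.2 hεε'
      refine div_le_div_of_nonneg_left (by norm_num) (by positivity) ?_
      exact mul_le_of_le_one_right hε.le (pow_le_one₀ h5.le (by linarith))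
    have h6 : 3 / ε = 3 * (1 / ε) := by ring
    push_cast
    linarith
  have hH : ((3 : ℕ) : ℝ) ≤ (4 * K + 8) * (N : ℝ) ^ ((ε' - ε) / 4) := by
    have := hpow ((ε' - ε) / 4) (by linarith)
    push_cast
    nlinarith
  have ha : ∀ (w : Fin N → S) i, (fun i => (e (w i)).val + 1) i ≤ 2 ^ p :=
    fun w i => (Nat.succ_le_of_lt (e (w i)).isLt).trans hnp
  have h2p : (0 : ℝ) < 1 / 2 ^ p := by positivity
  -- Halving `2^{-p}` turns `c * r ≤ r₀` into the strict inequality that separates `p`-bit vectors.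
  refine ⟨k + 1, 3, 3 + 2 * B, 3 + 2 * B, p, trieTransformer B k _ p, hL, hH, hdC, by omega, hdC,
    hpC, hasPrecision_trieTransformer _ _ _ _, fun w => ?_, 1 / 2 ^ p / 2, by positivity, ?_⟩
  · refine eval_trieTransformer e w rfl hB hnp hNp hk _ fun s h => ?_
    refine isExactAverage_of_isANNAWeights_trueQuery (ha w) hNp h le_rfl le_rfl
      (by simp) le_rfl ?_ (isANNAWeights_exactMatch fun i =>
        exists_trueKey_eq_trueQuery h i)
    rw [mul_one]
    exact_mod_cast hNp
  · intro r c ℓ hr hc hcr hl hlK η Ω _ μ _ A hA w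
    have hNl : N * ℓ ≤ 2 ^ p := by
      have h1 : ((K + 2 : ℕ) * N ^ (K + 2) : ℝ) ≤ 2 ^ p := by exact_mod_cast hp
      refine le_trans ?_ h1
      calc (N : ℝ) * ℓ ≤ N * (K * (N : ℝ) ^ K) := by gcongr
        _ = K * (N : ℝ) ^ (K + 1) := by ring
        _ ≤ (K + 2 : ℕ) * (N : ℝ) ^ (K + 2) := by
            gcongr
            · omega
            · exact one_le_two
    set a : Fin N → ℕ := fun i => (e (w i)).val + 1 with hadef
    -- The bad events refer to the true queries and keys, which do not depend on `ω`, so the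
    -- guarantee for fixed inputs applies in every layer. Outside all of them the computation
    -- follows the true tokens; no independence is needed.
    set F : Fin (k + 1) × Fin 3 → Set Ω := fun sh =>
      {ω | ¬ IsANNAWeights r c ℓ (trueQuery a B k (3 + 2 * B) sh.1 sh.2)
        (trueKey a B k (3 + 2 * B) sh.1 sh.2) (A sh.1 sh.2 ω
          (trueQuery a B k (3 + 2 * B) sh.1 sh.2) (trueKey a B k (3 + 2 * B) sh.1 sh.2))} with hF
    have hsub : {ω | (trieTransformer B k (3 + 2 * B) p).eval (fun l h => A l h ω)
        (inputRows e (3 + 2 * B) w) ≠ solutionRows e (3 + 2 * B) w} ⊆ ⋃ sh, F sh := by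
      intro ω hω
      by_contra hne
      refine hω (eval_trieTransformer e w rfl hB hnp hNp hk _ fun s h => ?_)
      refine isExactAverage_of_isANNAWeights_trueQuery (ha w) hNp h hr hc
        (hcr.trans_lt (half_lt_self h2p)) hl hNl ?_
      by_contra hbad
      exact hne (Set.mem_iUnion.2 ⟨(s, h), hbad⟩)
    calc μ _ ≤ μ (⋃ sh, F sh) := MeasureTheory.measure_mono hsub
      _ ≤ ∑ sh, μ (F sh) := MeasureTheory.measure_iUnion_fintype_le μ F
      _ ≤ ∑ _sh : Fin (k + 1) × Fin 3, η := by
          refine Finset.sum_le_sum fun sh _ => hA sh.1 sh.2 _ _ fun i => ?_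
          obtain ⟨j, hj⟩ := exists_trueKey_eq_trueQuery (a := a) (B := B) (k := k)
            (d := 3 + 2 * B) (s := sh.1) sh.2 i
          exact ⟨j, by rw [hj, eucDist_self]; exact hr⟩
      _ = _ := by simp [mul_assoc]
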